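/- Throughout, $\kappa,\lambda,\mu$ denote infinite regular cardinals. An \emph{AECat} is a pair $(\mathcal C,\mathcal M)$ where $\mathcal C$ and $\mathcal M$ are accessible categories, $\mathcal M$ is a full subcategory of $\mathcal C$ which has directed colimits, preserved by the inclusion into $\mathcal C$, and all arrows of $\mathcal C$ are monomorphisms. Objects of $\mathcal M$ are called \emph{models}, and an \emph{extension} of a model $M$ is an arrow $M\to N$ with $N$ a model. The AECat has the \emph{amalgamation property} if every span $N_1\leftarrow M\to N_2$ of models can be completed to a commutative square $N_1\to U\leftarrow N_2$ with $U$ a model. Given an extension $M\to N$, we view arrows into $M$ (and subobjects of $M$) as arrows into $N$ (subobjects of $N$) by composition. \textbf{Galois types.} For tuples of arrows $a_i:A_i\to M$ and $a_i':A_i\to M'$ into models, $\mathrm{gtp}((a_i)_i;M)=\mathrm{gtp}((a'_i)_i;M')$ means that there are extensions $M\to N\leftarrow M'$ such that $a_i$ and $a_i'$ become the same arrow into $N$ for all $i$. For tuples of subobjects, $\mathrm{gtp}((A_i)_i;M)=\mathrm{gtp}((A_i')_i;M')$ means that there are extensions $M\to N\leftarrow M'$ such that $A_i=A_i'$ as subobjects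 of $N$ for all $i$. \textbf{Isi-dividing.} An \emph{isi-sequence} over $c:C\to N$ consists of a sequence $(b_i)_{i<\lambda}$ of arrows $B\to N$ into a model $N$ together with a chain $(M_i)_{i<\lambda}$ of models with a cocone $m_i:M_i\to N$, such that $M_\ell=\operatorname{colim}_{i<\ell}M_i$ for limit $\ell<\lambda$, each $b_i$ factors through $m_{i+1}$, $c$ factors through $m_0$, and $\mathrm{gtp}(b_i,m_i;N)=\mathrm{gtp}(b_j,m_i;N)$ for all $i\le j<\lambda$. For arrows $a,b,c$ into a model $M$ and a sequence $(b_i)_{i\in I}$ in a model $N$ with an arrow $c:C\to N$, $\mathrm{gtp}(a,b,c;M)$ is \emph{consistent} for $(b_i)_{i\in I}$ if there are an extension $N\to N'$ and $a':A\to N'$ with $\mathrm{gtp}(a,b,c;M)=\mathrm{gtp}(a',b_i,c;N')$ for all $i\in I$. We say that $\mathrm{gtp}(a,b,c;M)$ \emph{isi-divides} over $c$ if there is $\mu$ such that for every $\lambda\ge\mu$ there is an isi-sequence $(b_i)_{i<\lambda}$ over $c$ in some model $N$ with $\mathrm{gtp}(b_i,c;N)=\mathrm{gtp}(b,c;M)$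 for all $i<\lambda$, such that for some $\kappa<\lambda$ and every $I\subseteq\lambda$ with $|I|\ge\kappa$, $\mathrm{gtp}(a,b,c;M)$ is inconsistent for $(b_i)_{i\in I}$. For subobjects $A,B,C$ of $M$, $\mathrm{gtp}(A,B,C;M)$ isi-divides over $C$ if $\mathrm{gtp}(a,b,c;M)$ isi-divides over $c$, where $a,b,c$ are representatives of $A,B,C$. \textbf{Simple independence relations.} An \emph{independence relation} is a relation $A\perp^M_C B$ on triples of subobjects of models $M$. Below, capital letters denote the subobjects represented by the corresponding lower case arrows. It is \emph{simple} if it has the following properties. \begin{itemize} \item Invariance: if $A\perp^M_C B$ and $\mathrm{gtp}(A,B,C;M)=\mathrm{gtp}(A',B',C';M')$ then $A'\perp^{M'}_{C'}B'$. \item Monotonicity: $A\perp^M_C B$ and $B'\le B$ imply $A\perp^M_C B'$. \item Base-monotonicity: $A\perp^M_C B$ and $C\le C'\le B$ imply $A\perp^M_{C'}B$. \item Transitivity: $A\perp^M_B C$, $A\perp^M_C D$ and $B\le C$ imply that there are an extension $M\to N$ and $E\le N$ with $A\perp^N_B E$ and $C,D\le E$. \item Symmetry: $A\perp^M_C B$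 implies $B\perp^M_C A$. \item Existence: for arrows $a:A\to M$ and $c:C\to M$ and any $B\le M$ there are an extension $M\to M'$ and $a':A\to M'$ with $A'\perp^{M'}_C B$ and $\mathrm{gtp}(a',c;M')=\mathrm{gtp}(a,c;M)$. \item Union: if $(B_i)_{i\in I}$ is a directed system in $\mathcal C$ with a cocone into a model $M$, $B=\operatorname{colim}_iB_i$ exists in $\mathcal C$, and $A\perp^M_C B_i$ for all $i$, then $A\perp^M_C B$. \item Local character: for every $\lambda$ there is $\Upsilon(\lambda)$ such that for all subobjects $A,B$ of a model $M$ with $A$ $\lambda$-presentable in $\mathcal C$ there is an $\Upsilon(\lambda)$-presentable $B'\le B$ with $A\perp^M_{B'}B$. \item 3-amalgamation: suppose that $A\perp^{N_1}_M B$, $B\perp^{N_2}_M C$, $C\perp^{N_3}_M A$ with $M$ a model, represented by arrows $a$ into $N_1,N_3$, $b$ into $N_1,N_2$, $c$ into $N_2,N_3$ and $m$ into $N_1,N_2,N_3$, such that $\mathrm{gtp}(a,m;N_1)=\mathrm{gtp}(a,m;N_3)$, $\mathrm{gtp}(b,m;N_1)=\mathrm{gtp}(b,m;N_2)$ and $\mathrm{gtp}(c,m;N_2)=\mathrm{gtp}(c,m;N_3)$.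 Then there are extensions $N_1,N_2,N_3\to N$ such that the two composites $A\to N$, the two composites $B\to N$, the two composites $C\to N$ and the three composites $M\to N$ coincide, and $A\perp^N_M N_2$. \end{itemize} \textbf{Theorem (Kim--Pillay theorem for AECats).} Let $(\mathcal C,\mathcal M)$ be an AECat with the amalgamation property and let $\perp$ be a simple independence relation on it. Let $A,B,C$ be subobjects of a model $M$. Then $A\perp^M_C B$ if and only if $\mathrm{gtp}(A,B,C;M)$ does not isi-divide over $C$ (for any choice of representatives of $A$, $B$, $C$). -/

import Mathlib

open CategoryTheory CategoryTheory.Limits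

universe v u

/-- An AECat (abstract elementary category): an accessible category `Obj` with a full
subcategory of *models* (given by the property `IsModel` of objects), which is itself accessible
and has directed colimits that are preserved by the inclusion, such that all arrows of `Obj` are
monomorphisms. "Small" means small relative to the universe `v` of the hom-sets; directed colimits
are the colimits of diagrams indexed by (small) nonempty directed posets. -/
structure AECat where
  /-- the objects of the ambient category -/
  Obj : Type u
  [category : Category.{v} Obj]
  /-- the objects that are models -/
  IsModel : ObjectProperty Obj
  accessible : IsAccessibleCategory.{v} Obj
  accessible_models : IsAccessibleCategory.{v} IsModel.FullSubcategory
  hasDirectedColimits : ∀ (J : Type v) [PartialOrder J] [IsDirectedOrder J] [Nonempty J],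
    HasColimitsOfShape J IsModel.FullSubcategory
  preservesDirectedColimits : ∀ (J : Type v) [PartialOrder J] [IsDirectedOrder J] [Nonempty J],
    PreservesColimitsOfShape J IsModel.ι
  mono : ∀ {X Y : Obj} (f : X ⟶ Y), Mono f

namespace AECat

instance (𝒦 : AECat.{v, u}) : Category.{v} 𝒦.Obj := 𝒦.category

instance (𝒦 : AECat.{v, u}) {X Y : 𝒦.Obj} (f : X ⟶ Y) : Mono f := 𝒦.mono f

/-- The models of an AECat. As they form a full subcategory, arrows `M ⟶ N` of models
(*extensions*) are written as arrows `M.obj ⟶ N.obj`. -/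
abbrev Model (𝒦 : AECat.{v, u}) : Type u := 𝒦.IsModel.FullSubcategory

/-- The amalgamation property, for spans of models. -/
def AmalgamationProperty (𝒦 : AECat.{v, u}) : Prop :=
  ∀ (M N₁ N₂ : 𝒦.Model) (f₁ : M.obj ⟶ N₁.obj) (f₂ : M.obj ⟶ N₂.obj),
    ∃ (U : 𝒦.Model) (g₁ : N₁.obj ⟶ U.obj) (g₂ : N₂.obj ⟶ U.obj), f₁ ≫ g₁ = f₂ ≫ g₂

variable {𝒦 : AECat.{v, u}}

/-- `gtp(x, y; M) = gtp(x', y'; M')`: equality of Galois types of pairs of arrows into models. -/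
def GtpEq₂ {X Y : 𝒦.Obj} {M M' : 𝒦.Model} (x : X ⟶ M.obj) (y : Y ⟶ M.obj)
    (x' : X ⟶ M'.obj) (y' : Y ⟶ M'.obj) : Prop :=
  ∃ (N : 𝒦.Model) (f : M.obj ⟶ N.obj) (g : M'.obj ⟶ N.obj), x ≫ f = x' ≫ g ∧ y ≫ f = y' ≫ g

/-- `gtp(x, y, z; M) = gtp(x', y', z'; M')`: equality of Galois types of triples of arrows into
models. -/
def GtpEq₃ {X Y Z : 𝒦.Obj} {M M' : 𝒦.Model} (x : X ⟶ M.obj) (y : Y ⟶ M.obj) (z : Z ⟶ M.obj)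
    (x' : X ⟶ M'.obj) (y' : Y ⟶ M'.obj) (z' : Z ⟶ M'.obj) : Prop :=
  ∃ (N : 𝒦.Model) (f : M.obj ⟶ N.obj) (g : M'.obj ⟶ N.obj),
    x ≫ f = x' ≫ g ∧ y ≫ f = y' ≫ g ∧ z ≫ f = z' ≫ g

/-- A subobject of `X`, viewed as a subobject of `Y` along an arrow `X ⟶ Y`. -/
noncomputable def push {X Y : 𝒦.Obj} (f : X ⟶ Y) (A : Subobject X) : Subobject Y :=
  (Subobject.map f).obj A

/-- `gtp(A, B, C; M) = gtp(A', B', C'; M')` for triples of subobjects of models. -/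
def SubGtpEq {M M' : 𝒦.Model} (A B C : Subobject M.obj) (A' B' C' : Subobject M'.obj) : Prop :=
  ∃ (N : 𝒦.Model) (f : M.obj ⟶ N.obj) (g : M'.obj ⟶ N.obj),
    push f A = push g A' ∧ push f B = push g B' ∧ push f C = push g C'

/-! ### Isi-sequences and isi-dividing -/

/-- A chain of initial segments for a sequence `(b i)`, `i < κ`, of arrows into a model `N`:
a continuous chain of models with a cocone to `N` such that every `b i` factors through the
`(i + 1)`-st model. Ordinals `i < κ` are the elements of `κ.ord.ToType`. -/
structure InitialSegments {κ : Cardinal.{v}} {Y : 𝒦.Obj} {N : 𝒦.Model}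
    (b : κ.ord.ToType → (Y ⟶ N.obj)) where
  chain : κ.ord.ToType ⥤ 𝒦.Obj
  isModel : ∀ i, 𝒦.IsModel (chain.obj i)
  continuous : chain.IsWellOrderContinuous
  toBound : chain ⟶ (Functor.const κ.ord.ToType).obj N.obj
  factors : ∀ i, ∃ g : Y ⟶ chain.obj (Order.succ i), g ≫ toBound.app (Order.succ i) = b i

/-- The arrow `mᵢ : Mᵢ ⟶ N` of a chain of initial segments. -/
def InitialSegments.m {κ : Cardinal.{v}} {Y : 𝒦.Obj} {N : 𝒦.Model}
    {b : κ.ord.ToType → (Y ⟶ N.obj)} (S : InitialSegments b) (i : κ.ord.ToType) :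
    S.chain.obj i ⟶ N.obj :=
  S.toBound.app i

/-- A sequence with a chain of initial segments is an isi-sequence (initial segment invariant)
if `gtp(bᵢ, mᵢ; N) = gtp(bⱼ, mᵢ; N)` for all `i ≤ j < κ`. -/
def InitialSegments.IsIsi {κ : Cardinal.{v}} {Y : 𝒦.Obj} {N : 𝒦.Model}
    {b : κ.ord.ToType → (Y ⟶ N.obj)} (S : InitialSegments b) : Prop :=
  ∀ i j, i ≤ j → GtpEq₂ (b i) (S.m i) (b j) (S.m i)

/-- `c : Z ⟶ N` embeds in the chain, that is, factors as `Z ⟶ M₀ ⟶ N` (compatibly with the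
cocone). For `κ > 0` there is exactly one minimal index. -/
def InitialSegments.Embeds {κ : Cardinal.{v}} {Y Z : 𝒦.Obj} {N : 𝒦.Model}
    {b : κ.ord.ToType → (Y ⟶ N.obj)} (S : InitialSegments b) (c : Z ⟶ N.obj) : Prop :=
  ∃ (i₀ : κ.ord.ToType) (_ : IsBot i₀) (h : Z ⟶ S.chain.obj i₀), h ≫ S.m i₀ = c

/-- `gtp(a, b, c; M)` is consistent for the sequence `(bs i)`, `i ∈ I`, of arrows into `N`, where
`c'` is the arrow into `N` that plays the role of `c`: there is an extension `f : N ⟶ N'` and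
`a' : X ⟶ N'` with `gtp(a, b, c; M) = gtp(a', bs i, c'; N')` for all `i`. -/
def Consistent {X Y Z : 𝒦.Obj} {M N : 𝒦.Model}
    (a : X ⟶ M.obj) (b : Y ⟶ M.obj) (c : Z ⟶ M.obj)
    {I : Type v} (bs : I → (Y ⟶ N.obj)) (c' : Z ⟶ N.obj) : Prop :=
  ∃ (N' : 𝒦.Model) (f : N.obj ⟶ N'.obj) (a' : X ⟶ N'.obj),
    ∀ i, GtpEq₃ a b c a' (bs i ≫ f) (c' ≫ f)

/-- `gtp(a, b, c; M)` isi-divides over `c`. The cardinals `μ`, `θ`, `κ` range over infinite regular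
cardinals. -/
def IsiDivides {X Y Z : 𝒦.Obj} {M : 𝒦.Model}
    (a : X ⟶ M.obj) (b : Y ⟶ M.obj) (c : Z ⟶ M.obj) : Prop :=
  ∃ μ : Cardinal.{v}, μ.IsRegular ∧ ∀ θ : Cardinal.{v}, θ.IsRegular → μ ≤ θ →
    ∃ (N : 𝒦.Model) (c' : Z ⟶ N.obj) (bs : θ.ord.ToType → (Y ⟶ N.obj))
      (S : InitialSegments bs),
      S.IsIsi ∧ S.Embeds c' ∧ (∀ i, GtpEq₂ (bs i) c' b c) ∧
      ∃ κ : Cardinal.{v}, κ.IsRegular ∧ κ < θ ∧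
        ∀ I : Set θ.ord.ToType, κ ≤ Cardinal.mk I →
          ¬ Consistent a b c (fun i : I => bs i) c'

/-! ### Independence relations -/

/-- An independence relation: a relation on triples of subobjects of models. `R A B C`, for
subobjects `A`, `B`, `C` of a model `M`, reads "`A` is independent from `B` over `C` in `M`". -/
def IndepRel (𝒦 : AECat.{v, u}) : Type (max u v) :=
  ∀ ⦃M : 𝒦.Model⦄, Subobject M.obj → Subobject M.obj → Subobject M.obj → Prop

namespace IndepRel

variable (R : IndepRel 𝒦)

def Invariance : Prop :=
  ∀ ⦃M M' : 𝒦.Model⦄ (A B C : Subobject M.obj) (A' B' C' : Subobject M'.obj),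
    R A B C → SubGtpEq A B C A' B' C' → R A' B' C'

def Monotonicity : Prop :=
  ∀ ⦃M : 𝒦.Model⦄ (A B B' C : Subobject M.obj), R A B C → B' ≤ B → R A B' C

def BaseMonotonicity : Prop :=
  ∀ ⦃M : 𝒦.Model⦄ (A B C C' : Subobject M.obj), R A B C → C ≤ C' → C' ≤ B → R A B C'

def Transitivity : Prop :=
  ∀ ⦃M : 𝒦.Model⦄ (A B C D : Subobject M.obj), R A C B → R A D C → B ≤ C →
    ∃ (N : 𝒦.Model) (f : M.obj ⟶ N.obj) (E : Subobject N.obj),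
      R (push f A) E (push f B) ∧ push f C ≤ E ∧ push f D ≤ E

def Symmetry : Prop :=
  ∀ ⦃M : 𝒦.Model⦄ (A B C : Subobject M.obj), R A B C → R B A C

def Existence : Prop :=
  ∀ ⦃M : 𝒦.Model⦄ ⦃X Z : 𝒦.Obj⦄ (a : X ⟶ M.obj) (c : Z ⟶ M.obj) (B : Subobject M.obj),
    ∃ (M' : 𝒦.Model) (f : M.obj ⟶ M'.obj) (a' : X ⟶ M'.obj),
      R (Subobject.mk a') (push f B) (Subobject.mk (c ≫ f)) ∧ GtpEq₂ a' (c ≫ f) a c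

/-- If a directed system has a colimit `s` in the ambient category and a cocone into a model `M`,
corresponding to an arrow `d : s.pt ⟶ M`, and `A` is independent over `C` from every object of the
system, then `A` is independent over `C` from the colimit. -/
def Union : Prop :=
  ∀ (J : Type v) [PartialOrder J] [IsDirectedOrder J] [Nonempty J] (F : J ⥤ 𝒦.Obj)
    (s : Cocone F) (_ : IsColimit s) ⦃M : 𝒦.Model⦄ (d : s.pt ⟶ M.obj) (A C : Subobject M.obj),
    (∀ j, R A (Subobject.mk (s.ι.app j ≫ d)) C) → R A (Subobject.mk d) C

def LocalCharacter : Prop :=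
  ∀ (κ : Cardinal.{v}) [Fact κ.IsRegular], ∃ (Υ : Cardinal.{v}) (_ : Fact Υ.IsRegular),
    ∀ ⦃M : 𝒦.Model⦄ (A B : Subobject M.obj), IsCardinalPresentable (A : 𝒦.Obj) κ →
      ∃ B' : Subobject M.obj, B' ≤ B ∧ IsCardinalPresentable (B' : 𝒦.Obj) Υ ∧ R A B B'

def ThreeAmalgamation : Prop :=
  ∀ ⦃A B C : 𝒦.Obj⦄ ⦃M N₁ N₂ N₃ : 𝒦.Model⦄
    (a₁ : A ⟶ N₁.obj) (a₃ : A ⟶ N₃.obj) (b₁ : B ⟶ N₁.obj) (b₂ : B ⟶ N₂.obj)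
    (c₂ : C ⟶ N₂.obj) (c₃ : C ⟶ N₃.obj)
    (m₁ : M.obj ⟶ N₁.obj) (m₂ : M.obj ⟶ N₂.obj) (m₃ : M.obj ⟶ N₃.obj),
    R (Subobject.mk a₁) (Subobject.mk b₁) (Subobject.mk m₁) →
    R (Subobject.mk b₂) (Subobject.mk c₂) (Subobject.mk m₂) →
    R (Subobject.mk c₃) (Subobject.mk a₃) (Subobject.mk m₃) →
    GtpEq₂ a₁ m₁ a₃ m₃ → GtpEq₂ b₁ m₁ b₂ m₂ → GtpEq₂ c₂ m₂ c₃ m₃ →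
    ∃ (N : 𝒦.Model) (f₁ : N₁.obj ⟶ N.obj) (f₂ : N₂.obj ⟶ N.obj) (f₃ : N₃.obj ⟶ N.obj),
      a₁ ≫ f₁ = a₃ ≫ f₃ ∧ b₁ ≫ f₁ = b₂ ≫ f₂ ∧ c₂ ≫ f₂ = c₃ ≫ f₃ ∧
      m₁ ≫ f₁ = m₂ ≫ f₂ ∧ m₁ ≫ f₁ = m₃ ≫ f₃ ∧
      R (Subobject.mk (a₁ ≫ f₁)) (Subobject.mk f₂) (Subobject.mk (m₁ ≫ f₁))

/-- A simple independence relation. -/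
structure IsSimple : Prop where
  invariance : R.Invariance
  monotonicity : R.Monotonicity
  baseMonotonicity : R.BaseMonotonicity
  transitivity : R.Transitivity
  symmetry : R.Symmetry
  existence : R.Existence
  union : R.Union
  localCharacter : R.LocalCharacter
  threeAmalgamation : R.ThreeAmalgamation

end IndepRel

end AECat

/-!
Let `R.Indep a b c`. Along an isi-sequence in `gtp(b, c)` of length a successor of a large regular
cardinal, local character yields a limit `l` and `j < l` such that the `bᵢ`, `j ≤ i < l`, are
independent from `Mᵢ` over the model `M_j`. A realization of `gtp(a, b, c)` at `b_j` that is
independent from `b_j` over `M_j` can then be amalgamated with the `bᵢ` one after the other by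
3-amalgamation, so that `gtp(a, b, c)` is consistent for `(bᵢ)_{j ≤ i < l}`, which is too long for
isi-dividing.

Conversely, existence, transitivity and union give arbitrarily long isi-sequences in `gtp(b, c)`
with every `bᵢ` independent from `Mᵢ` over `c`. If `a'` witnesses consistency on a large set `I` of
indices, local character makes `a'` independent from some `bᵢ`, `i ∈ I`, over `Mᵢ`. By symmetry and
transitivity `bᵢ` is independent from `a'` over `c`, hence `R.Indep a b c` by invariance.
-/

section Iteration

lemma hasIterationOfShape_of_hasColimitsOfShape {K : Type v} [LinearOrder K] [Nonempty K]
    {D : Type*} [Category* D]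
    (hD : ∀ (J : Type v) [LinearOrder J] [Nonempty J], HasColimitsOfShape J D) :
    HasIterationOfShape K D where
  hasColimitsOfShape_of_isSuccLimit l hl := by
    obtain ⟨k, hk⟩ := not_isMin_iff.1 hl.1
    have : Nonempty (Set.Iio l) := ⟨⟨k, hk⟩⟩
    exact hD (Set.Iio l)
  hasColimitsOfShape := hD K

lemma isWellOrderContinuous_comp {K : Type v} [LinearOrder K] {D E : Type*} [Category* D]
    [Category* E] (F : K ⥤ D) [F.IsWellOrderContinuous] (G : D ⥤ E)
    (hG : ∀ (J : Type v) [LinearOrder J] [Nonempty J], PreservesColimitsOfShape J G) :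
    (F ⋙ G).IsWellOrderContinuous where
  nonempty_isColimit l hl := by
    obtain ⟨k, hk⟩ := not_isMin_iff.1 hl.1
    have : Nonempty (Set.Iio l) := ⟨⟨k, hk⟩⟩
    have := hG (Set.Iio l)
    exact ⟨isColimitOfPreserves G (F.isColimitOfIsWellOrderContinuous l hl)⟩

variable {D : Type*} [Category* D] {K : Type*} [LinearOrder K] [SuccOrder K] [NoMaxOrder K]
  [OrderBot K] [WellFoundedLT K] [HasIterationOfShape K D] [Nonempty D]

lemma exists_isWellOrderContinuous_forall_map_succ (W : MorphismProperty D)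
    (hW : ∀ s, ∃ (t : D) (f : s ⟶ t), W f) :
    ∃ F : K ⥤ D, F.IsWellOrderContinuous ∧ ∀ k, W (F.map (homOfLE (Order.le_succ k))) := by
  choose succ toSucc h using hW
  let Φ : SmallObject.SuccStruct D := ⟨Classical.arbitrary D, succ, fun {s} => toSucc s⟩
  have prop_le : Φ.prop ≤ W := (MorphismProperty.ofHoms_le_iff _ _).2 h
  exact ⟨Φ.iterationFunctor K, inferInstance, fun k =>
    prop_le _ (Φ.prop_iterationFunctor_map_succ k (not_isMax k))⟩

-- Each step of the iteration deals with the least index at which `P` still fails.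
lemma exists_forall_of_forall_exists_hom (P : K → ObjectProperty D)
    (map : ∀ {k : K} {s t : D}, (s ⟶ t) → P k s → P k t)
    (extend : ∀ (k : K) (s : D), (∀ i < k, P i s) → ∃ t, Nonempty (s ⟶ t) ∧ P k t) :
    ∃ s, ∀ k, P k s := by
  have exists_succ (s : D) : ∃ (t : D) (_ : s ⟶ t), ∀ k, (∀ i < k, P i s) → P k t := by
    by_cases h : ∃ k, ¬ P k s
    · obtain ⟨k, hk, hmin⟩ := WellFounded.has_min (wellFounded_lt (α := K)) {k | ¬ P k s} h
      have lt_holds (i : K) (hi : i < k) : P i s := not_not.1 fun h => hmin i h hi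
      obtain ⟨t, ⟨f⟩, ht⟩ := extend k s lt_holds
      refine ⟨t, f, fun l hl => ?_⟩
      rcases lt_trichotomy l k with h | rfl | h
      · exact map f (lt_holds l h)
      · exact ht
      · exact (hk (hl k h)).elim
    · push Not at h
      exact ⟨s, 𝟙 s, fun k _ => h k⟩
  obtain ⟨F, -, hF⟩ := exists_isWellOrderContinuous_forall_map_succ (K := K)
    (fun s t _ => ∀ k, (∀ i < k, P i s) → P k t) exists_succ
  have holds (k : K) : P k (F.obj (Order.succ k)) := by
    induction k using WellFoundedLT.induction with
    | _ k ih => exact hF k k fun i hi => map (F.map (homOfLE (Order.succ_le_of_lt hi))) (ih i hi)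
  exact ⟨colimit F, fun k => map (colimit.ι F _) (holds k)⟩

end Iteration

section ClosedUnderColimits

variable {J : Type*} [Category* J]

lemma isClosedUnderColimitsOfShape_sup_of_forall_hom {D : Type*} [Category* D]
    {P Q : ObjectProperty D} (hP : ∀ {s t : D}, (s ⟶ t) → P s → P t)
    [Q.IsClosedUnderColimitsOfShape J] : (P ⊔ Q).IsClosedUnderColimitsOfShape J where
  colimitsOfShape_le := fun t ⟨p⟩ => by
    by_cases h : ∃ j, P (p.diag.obj j)
    · obtain ⟨j, hj⟩ := h
      exact Or.inl (hP (p.ι.app j) hj)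
    · exact Or.inr (Q.prop_of_isColimit p.isColimit fun j =>
        (p.prop_diag_obj j).resolve_left fun hj => h ⟨j, hj⟩)

variable {D E : Type*} [Category* D] [Category* E] {G : D ⥤ E} {T W : E}

lemma exists_comp_eq_of_isColimit {F : J ⥤ E} {s : Cocone F} (hs : IsColimit s) (w : W ⟶ T)
    [Mono w] (n : s.pt ⟶ T) (h : ∀ j, ∃ g : F.obj j ⟶ W, g ≫ w = s.ι.app j ≫ n) :
    ∃ g : s.pt ⟶ W, g ≫ w = n := by
  choose g hg using h
  let σ : Cocone F :=
    { pt := W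
      ι.app := g
      ι.naturality := fun i j f => by
        rw [← cancel_mono w, Category.assoc, hg]
        simp [hg] }
  exact ⟨hs.desc σ, hs.hom_ext fun j => by rw [hs.fac_assoc, hg]⟩

/-- The costructured arrows `G.obj s ⟶ T` that factor through `w : W ⟶ T`. -/
def costructuredArrowFactors (G : D ⥤ E) (w : W ⟶ T) : ObjectProperty (CostructuredArrow G T) :=
  fun s => ∃ g : G.obj s.left ⟶ W, g ≫ w = s.hom

lemma isClosedUnderColimitsOfShape_costructuredArrowFactors [HasColimitsOfShape J D]
    [PreservesColimitsOfShape J G] (w : W ⟶ T) [Mono w] :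
    (costructuredArrowFactors G w).IsClosedUnderColimitsOfShape J where
  colimitsOfShape_le := fun t ⟨p⟩ => by
    refine exists_comp_eq_of_isColimit
      (isColimitOfPreserves (CostructuredArrow.proj G T ⋙ G) p.isColimit) w t.hom fun j => ?_
    obtain ⟨g, hg⟩ := p.prop_diag_obj j
    exact ⟨g, hg.trans (CostructuredArrow.w (p.ι.app j)).symm⟩

end ClosedUnderColimits

section Cardinals

open Cardinal Set

lemma exists_le_mk_inter_Iio {θ κ : Cardinal.{v}} (hθ : θ.IsRegular) (hκθ : κ < θ)
    {I : Set θ.ord.ToType} (hI : κ ≤ #I) : ∃ l, κ ≤ #(I ∩ Iio l : Set θ.ord.ToType) := by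
  obtain ⟨I', hI', hcard⟩ := le_mk_iff_exists_subset.1 hI
  have bounded : ∃ l, ∀ i ∈ I', i < l := by
    by_contra! hcof
    have : Order.cof θ.ord.ToType ≤ #I' := Order.cof_le hcof
    rw [Ordinal.cof_toType, hθ.cof_ord, hcard] at this
    exact hκθ.not_ge this
  obtain ⟨l, hl⟩ := bounded
  exact ⟨l, hcard.ge.trans (mk_le_mk_of_subset fun i hi => ⟨hI' hi, hl i hi⟩)⟩

variable {K : Type v} [LinearOrder K] {κ : Cardinal.{v}}

lemma isCardinalFiltered_Iio_of_mk_inter_lt [hκ : Fact κ.IsRegular] {I : Set K} {l : K}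
    (hl : κ ≤ #(I ∩ Iio l : Set K)) (hlt : ∀ j < l, #(I ∩ Iio j : Set K) < κ) :
    IsCardinalFiltered (Iio l) κ :=
  isCardinalFiltered_preorder _ _ fun J s hJ => by
    by_contra! unbounded
    have cover : I ∩ Iio l ⊆ ⋃ j, I ∩ Iio (s j).1 := by
      rintro x ⟨hxI, hxl⟩
      obtain ⟨j, hj⟩ := unbounded ⟨x, hxl⟩
      exact mem_iUnion.2 ⟨j, hxI, hj⟩
    refine hl.not_gt ((mk_le_mk_of_subset cover).trans_lt (mk_iUnion_le_sum_mk.trans_lt ?_))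
    exact sum_lt_of_isRegular hκ.out hJ fun j => hlt _ (s j).2

lemma le_mk_inter_Ioo_of_mk_inter_lt (hκ : ℵ₀ ≤ κ) {I : Set K} {j l : K}
    (hl : κ ≤ #(I ∩ Iio l : Set K)) (hlt : #(I ∩ Iio j : Set K) < κ) :
    κ ≤ #(I ∩ Ioo j l : Set K) := by
  have cover : I ∩ Iio l ⊆ insert j (I ∩ Iio j) ∪ (I ∩ Ioo j l) := by
    rintro x ⟨hxI, hxl⟩
    rcases lt_trichotomy x j with h | rfl | h
    · exact Or.inl (Or.inr ⟨hxI, h⟩)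
    · exact Or.inl (Or.inl rfl)
    · exact Or.inr ⟨hxI, h, hxl⟩
  by_contra! hIoo
  refine hl.not_gt ((mk_le_mk_of_subset cover).trans_lt ((mk_union_le _ _).trans_lt ?_))
  exact add_lt_of_lt hκ (mk_insert_le.trans_lt (add_lt_of_lt hκ hlt
    (one_lt_aleph0.trans_le hκ))) hIoo

lemma exists_isSuccLimit_isCardinalFiltered_Iio [WellFoundedLT K] [hκ : Fact κ.IsRegular]
    {I : Set K} (hI : ∃ l, κ ≤ #(I ∩ Iio l : Set K)) :
    ∃ l, Order.IsSuccLimit l ∧ IsCardinalFiltered (Iio l) κ ∧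
      ∀ j < l, κ ≤ #(I ∩ Ioo j l : Set K) := by
  obtain ⟨l, hl, hmin⟩ := WellFounded.has_min (wellFounded_lt (α := K)) _ hI
  have hlt (j : K) (hj : j < l) : #(I ∩ Iio j : Set K) < κ := not_le.1 fun h => hmin j h hj
  have filtered := isCardinalFiltered_Iio_of_mk_inter_lt hl hlt
  have tail (j : K) (hj : j < l) := le_mk_inter_Ioo_of_mk_inter_lt hκ.out.aleph0_le hl (hlt j hj)
  refine ⟨l, ⟨?_, fun j hj => ?_⟩, filtered, tail⟩
  · obtain ⟨j⟩ := (isFiltered_of_isCardinalFiltered (Iio l) κ).nonempty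
    exact not_isMin_of_lt j.2
  · refine (hκ.out.pos.trans_le (tail j hj.lt)).ne' ?_
    rw [hj.Ioo_eq, inter_empty, mk_eq_zero]

end Cardinals

namespace AECat

variable {𝒦 : AECat.{v, u}}

section GaloisTypes

variable {X Y Z W : 𝒦.Obj} {M M' M'' N : 𝒦.Model}
  {x : X ⟶ M.obj} {y : Y ⟶ M.obj} {z : Z ⟶ M.obj}
  {x' : X ⟶ M'.obj} {y' : Y ⟶ M'.obj} {z' : Z ⟶ M'.obj}
  {x'' : X ⟶ M''.obj} {y'' : Y ⟶ M''.obj} {z'' : Z ⟶ M''.obj}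

lemma GtpEq₂.of_hom (x : X ⟶ M.obj) (y : Y ⟶ M.obj) (f : M.obj ⟶ N.obj) :
    GtpEq₂ x y (x ≫ f) (y ≫ f) :=
  ⟨N, f, 𝟙 _, by simp, by simp⟩

lemma GtpEq₂.symm (h : GtpEq₂ x y x' y') : GtpEq₂ x' y' x y := by
  obtain ⟨N, f, g, hx, hy⟩ := h
  exact ⟨N, g, f, hx.symm, hy.symm⟩

lemma GtpEq₂.trans (hAP : 𝒦.AmalgamationProperty) (h : GtpEq₂ x y x' y')
    (h' : GtpEq₂ x' y' x'' y'') : GtpEq₂ x y x'' y'' := by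
  obtain ⟨N, f, g, hx, hy⟩ := h
  obtain ⟨N', f', g', hx', hy'⟩ := h'
  obtain ⟨U, p, q, e⟩ := hAP M' N N' g f'
  refine ⟨U, f ≫ p, g' ≫ q, ?_, ?_⟩
  · rw [reassoc_of% hx, e, reassoc_of% hx']
  · rw [reassoc_of% hy, e, reassoc_of% hy']

lemma GtpEq₂.gtpEq₃ (h : GtpEq₂ x y x' y') (t : Z ⟶ Y) :
    GtpEq₃ x y (t ≫ y) x' y' (t ≫ y') := by
  obtain ⟨N, f, g, hx, hy⟩ := h
  exact ⟨N, f, g, hx, hy, by rw [Category.assoc, hy, Category.assoc]⟩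

lemma GtpEq₃.gtpEq₂ (h : GtpEq₃ x y z x' y' z') : GtpEq₂ x z x' z' := by
  obtain ⟨N, f, g, hx, -, hz⟩ := h
  exact ⟨N, f, g, hx, hz⟩

lemma GtpEq₂.precomp (h : GtpEq₂ x y x' y') (t : Z ⟶ Y) : GtpEq₂ x (t ≫ y) x' (t ≫ y') :=
  (h.gtpEq₃ t).gtpEq₂

lemma GtpEq₃.of_hom (x : X ⟶ M.obj) (y : Y ⟶ M.obj) (z : Z ⟶ M.obj) (f : M.obj ⟶ N.obj) :
    GtpEq₃ x y z (x ≫ f) (y ≫ f) (z ≫ f) :=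
  ⟨N, f, 𝟙 _, by simp, by simp, by simp⟩

lemma GtpEq₃.symm (h : GtpEq₃ x y z x' y' z') : GtpEq₃ x' y' z' x y z := by
  obtain ⟨N, f, g, hx, hy, hz⟩ := h
  exact ⟨N, g, f, hx.symm, hy.symm, hz.symm⟩

lemma GtpEq₃.trans (hAP : 𝒦.AmalgamationProperty) (h : GtpEq₃ x y z x' y' z')
    (h' : GtpEq₃ x' y' z' x'' y'' z'') : GtpEq₃ x y z x'' y'' z'' := by
  obtain ⟨N, f, g, hx, hy, hz⟩ := h
  obtain ⟨N', f', g', hx', hy', hz'⟩ := h'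
  obtain ⟨U, p, q, e⟩ := hAP M' N N' g f'
  refine ⟨U, f ≫ p, g' ≫ q, ?_, ?_, ?_⟩
  · rw [reassoc_of% hx, e, reassoc_of% hx']
  · rw [reassoc_of% hy, e, reassoc_of% hy']
  · rw [reassoc_of% hz, e, reassoc_of% hz']

lemma GtpEq₃.precomp (h : GtpEq₃ x y z x' y' z') (t : W ⟶ Z) :
    GtpEq₃ x y (t ≫ z) x' y' (t ≫ z') := by
  obtain ⟨N, f, g, hx, hy, hz⟩ := h
  exact ⟨N, f, g, hx, hy, by rw [Category.assoc, hz, Category.assoc]⟩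

lemma Consistent.precomp {I : Type v} {bs : I → (Y ⟶ N.obj)} {c : Z ⟶ N.obj}
    (h : Consistent x y z bs c) (t : W ⟶ Z) : Consistent x y (t ≫ z) bs (t ≫ c) := by
  obtain ⟨N', f, a, ha⟩ := h
  exact ⟨N', f, a, fun i => by simpa only [Category.assoc] using (ha i).precomp t⟩

lemma Consistent.of_gtpEq₃ (hAP : 𝒦.AmalgamationProperty) {I : Type v}
    {bs : I → (Y ⟶ N.obj)} {c : Z ⟶ N.obj} (e : GtpEq₃ x y z x' y' z')
    (h : Consistent x' y' z' bs c) : Consistent x y z bs c := by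
  obtain ⟨N', f, a, ha⟩ := h
  exact ⟨N', f, a, fun i => e.trans hAP (ha i)⟩

end GaloisTypes

/-- The independence relation on arrows: the subobjects that they represent are independent. -/
abbrev IndepRel.Indep (R : IndepRel 𝒦) {X Y Z : 𝒦.Obj} {M : 𝒦.Model}
    (a : X ⟶ M.obj) (b : Y ⟶ M.obj) (c : Z ⟶ M.obj) : Prop :=
  R (Subobject.mk a) (Subobject.mk b) (Subobject.mk c)

@[simp]
lemma push_mk {X Y A : 𝒦.Obj} (f : X ⟶ Y) (a : A ⟶ X) :
    push f (Subobject.mk a) = Subobject.mk (a ≫ f) :=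
  Subobject.map_mk a f

namespace IndepRel.IsSimple

variable {R : IndepRel 𝒦} {X Y Z W : 𝒦.Obj} {M M' N : 𝒦.Model}
  {a : X ⟶ M.obj} {b : Y ⟶ M.obj} {c : Z ⟶ M.obj} {d : W ⟶ M.obj}

lemma indep_symm (hR : R.IsSimple) (h : R.Indep a b c) : R.Indep b a c :=
  hR.symmetry _ _ _ h

lemma indep_of_gtpEq₃ (hR : R.IsSimple) {a' : X ⟶ M'.obj} {b' : Y ⟶ M'.obj} {c' : Z ⟶ M'.obj}
    (h : R.Indep a b c) (e : GtpEq₃ a b c a' b' c') : R.Indep a' b' c' := by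
  obtain ⟨N, f, g, ha, hb, hc⟩ := e
  exact hR.invariance _ _ _ _ _ _ h ⟨N, f, g, by simp [ha], by simp [hb], by simp [hc]⟩

lemma indep_comp_iff (hR : R.IsSimple) (f : M.obj ⟶ N.obj) :
    R.Indep (a ≫ f) (b ≫ f) (c ≫ f) ↔ R.Indep a b c :=
  ⟨fun h => hR.indep_of_gtpEq₃ h (GtpEq₃.of_hom a b c f).symm,
    fun h => hR.indep_of_gtpEq₃ h (GtpEq₃.of_hom a b c f)⟩

lemma indep_precomp_right (hR : R.IsSimple) (h : R.Indep a b c) (t : W ⟶ Y) :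
    R.Indep a (t ≫ b) c :=
  hR.monotonicity _ _ _ _ h (Subobject.mk_le_mk_of_comm t rfl)

lemma indep_base_mono (hR : R.IsSimple) (h : R.Indep a b c) (s : Z ⟶ W) (hs : s ≫ d = c)
    (t : W ⟶ Y) (ht : t ≫ b = d) : R.Indep a b d :=
  hR.baseMonotonicity _ _ _ _ h (Subobject.mk_le_mk_of_comm s hs) (Subobject.mk_le_mk_of_comm t ht)

lemma exists_indep_above (hR : R.IsSimple) (hb : R.Indep a b c) (hd : R.Indep a d b) (s : Z ⟶ Y)
    (hs : s ≫ b = c) :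
    ∃ (N : 𝒦.Model) (f : M.obj ⟶ N.obj) (E : 𝒦.Obj) (e : E ⟶ N.obj),
      R.Indep (a ≫ f) e (c ≫ f) ∧ (∃ p, p ≫ e = b ≫ f) ∧ ∃ p, p ≫ e = d ≫ f := by
  obtain ⟨N, f, E, hE, hbE, hdE⟩ :=
    hR.transitivity _ _ _ _ hb hd (Subobject.mk_le_mk_of_comm s hs)
  simp only [push_mk] at hE hbE hdE
  refine ⟨N, f, _, E.arrow, ?_, ⟨Subobject.ofMkLE _ _ hbE, by simp⟩,
    ⟨Subobject.ofMkLE _ _ hdE, by simp⟩⟩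
  rwa [Indep, Subobject.mk_arrow]

lemma indep_trans (hR : R.IsSimple) (hb : R.Indep a b c) (hd : R.Indep a d b) (s : Z ⟶ Y)
    (hs : s ≫ b = c) : R.Indep a d c := by
  obtain ⟨N, f, E, e, he, -, p, hp⟩ := hR.exists_indep_above hb hd s hs
  rw [← hR.indep_comp_iff f, ← hp]
  exact hR.indep_precomp_right he p

lemma exists_indep_gtpEq₂ (hR : R.IsSimple) (a : X ⟶ M.obj) (b : Y ⟶ M.obj) (c : Z ⟶ M.obj) :
    ∃ (N : 𝒦.Model) (f : M.obj ⟶ N.obj) (a' : X ⟶ N.obj),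
      R.Indep a' (b ≫ f) (c ≫ f) ∧ GtpEq₂ a' (c ≫ f) a c := by
  simpa only [push_mk] using hR.existence a c (Subobject.mk b)

lemma indep_self_right (hR : R.IsSimple) (a : X ⟶ M.obj) (c : Z ⟶ M.obj) : R.Indep a c c := by
  obtain ⟨N, f, a', h, e⟩ := hR.exists_indep_gtpEq₂ a c c
  refine hR.indep_of_gtpEq₃ h ?_
  simpa only [Category.id_comp] using e.gtpEq₃ (𝟙 Z)

lemma exists_indep_of_base_le (hR : R.IsSimple) (h : R.Indep a b c) (s : Z ⟶ Y)
    (hs : s ≫ b = c) (d : W ⟶ M.obj) :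
    ∃ (N : 𝒦.Model) (f : M.obj ⟶ N.obj) (a' : X ⟶ N.obj),
      GtpEq₂ a b a' (b ≫ f) ∧ R.Indep a' (d ≫ f) (c ≫ f) := by
  subst hs
  obtain ⟨N, f, a', h', e⟩ := hR.exists_indep_gtpEq₂ a d b
  refine ⟨N, f, a', e.symm, ?_⟩
  have hb : R.Indep a' (b ≫ f) (s ≫ b ≫ f) := hR.indep_of_gtpEq₃ h (e.symm.gtpEq₃ s)
  simpa only [Category.assoc] using hR.indep_trans hb h' s rfl

lemma exists_indep_gtpEq₃ (hR : R.IsSimple) (h : R.Indep a b c) (d : W ⟶ M.obj) :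
    ∃ (N : 𝒦.Model) (f : M.obj ⟶ N.obj) (a' : X ⟶ N.obj),
      GtpEq₃ a b c a' (b ≫ f) (c ≫ f) ∧ R.Indep a' (d ≫ f) (c ≫ f) := by
  obtain ⟨N, f, E, e, he, ⟨s, hs⟩, ⟨t, ht⟩⟩ :=
    hR.exists_indep_above (hR.indep_self_right a c) h (𝟙 _) (Category.id_comp _)
  obtain ⟨N', g, a', ⟨U, p, q, hp, hq⟩, h'⟩ := hR.exists_indep_of_base_le he s hs (d ≫ f)
  refine ⟨N', f ≫ g, a', ⟨U, f ≫ p, q, ?_, ?_, ?_⟩, by simpa only [Category.assoc] using h'⟩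
  · rw [← hp, Category.assoc]
  · rw [← reassoc_of% ht, hq]
    simp only [Category.assoc, reassoc_of% ht]
  · rw [← reassoc_of% hs, hq]
    simp only [Category.assoc, reassoc_of% hs]

lemma exists_indep_of_gtpEq₂ (hAP : 𝒦.AmalgamationProperty) (hR : R.IsSimple)
    (h : R.Indep a b c) {b' : Y ⟶ N.obj} {c' : Z ⟶ N.obj} (e : GtpEq₂ b c b' c')
    (d : W ⟶ N.obj) :
    ∃ (N' : 𝒦.Model) (f : N.obj ⟶ N'.obj) (a' : X ⟶ N'.obj),
      GtpEq₃ a b c a' (b' ≫ f) (c' ≫ f) ∧ R.Indep a' (d ≫ f) (c' ≫ f) := by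
  obtain ⟨U, p, q, hb, hc⟩ := e
  obtain ⟨N', f, a', hgtp, hind⟩ :=
    hR.exists_indep_gtpEq₃ ((hR.indep_comp_iff p).2 h) (d ≫ q)
  refine ⟨N', q ≫ f, a', ?_, ?_⟩
  · simpa only [hb, hc, Category.assoc] using (GtpEq₃.of_hom a b c p).trans hAP hgtp
  · simpa only [hc, Category.assoc] using hind

end IndepRel.IsSimple

section LocalCharacter

/-- Local character for a fixed domain `X`: every arrow out of `X` is independent from any arrow
`b` over an arrow that factors through `b` and whose domain is `Υ`-presentable. -/
def IndepRel.HasPresentableBases (R : IndepRel 𝒦) (X : 𝒦.Obj) (Υ : Cardinal.{v})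
    [Fact Υ.IsRegular] : Prop :=
  ∀ ⦃N : 𝒦.Model⦄ ⦃Y : 𝒦.Obj⦄ (a : X ⟶ N.obj) (b : Y ⟶ N.obj),
    ∃ (W : 𝒦.Obj) (w : W ⟶ Y), IsCardinalPresentable W Υ ∧ R.Indep a b (w ≫ b)

variable {R : IndepRel 𝒦} {X : 𝒦.Obj} {N : 𝒦.Model}

lemma IndepRel.IsSimple.exists_hasPresentableBases (hR : R.IsSimple) (X : 𝒦.Obj) :
    ∃ (Υ : Cardinal.{v}) (_ : Fact Υ.IsRegular), R.HasPresentableBases X Υ := by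
  have := 𝒦.accessible
  obtain ⟨κ, hκ, hX⟩ : ∃ (κ : Cardinal.{v}) (_ : Fact κ.IsRegular), IsCardinalPresentable X κ :=
    (inferInstance : IsPresentable.{v} X).exists_cardinal
  obtain ⟨Υ, hΥ, h⟩ := hR.localCharacter κ
  refine ⟨Υ, hΥ, fun N Y a b => ?_⟩
  obtain ⟨B', hle, hB', hind⟩ := h (Subobject.mk a) (Subobject.mk b)
    (isCardinalPresentable_of_iso (Subobject.underlyingIso a).symm κ)
  refine ⟨B', Subobject.ofLEMk _ _ hle, hB', ?_⟩
  rwa [Indep, Subobject.ofLEMk_comp, Subobject.mk_arrow]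

lemma IndepRel.IsSimple.exists_forall_indep_of_isColimit {Υ : Cardinal.{v}} [Fact Υ.IsRegular]
    (hR : R.IsSimple) (hΥ : R.HasPresentableBases X Υ) {J : Type v} [SmallCategory J]
    [IsCardinalFiltered J Υ] {F : J ⥤ 𝒦.Obj} {s : Cocone F} (hs : IsColimit s)
    (a : X ⟶ N.obj) (d : s.pt ⟶ N.obj) :
    ∃ k, ∀ x, (k ⟶ x) → R.Indep a d (s.ι.app x ≫ d) := by
  obtain ⟨W, w, hW, h⟩ := hΥ a d
  obtain ⟨k, w', rfl⟩ := IsCardinalPresentable.exists_hom_of_isColimit Υ hs w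
  exact ⟨k, fun x f => hR.indep_base_mono h (w' ≫ F.map f) (by simp) (s.ι.app x) rfl⟩

variable {θ : Cardinal.{v}} {Y : 𝒦.Obj} {bs : θ.ord.ToType → (Y ⟶ N.obj)}

@[simp]
lemma InitialSegments.map_comp_m (S : InitialSegments bs) {i j : θ.ord.ToType} (f : i ⟶ j) :
    S.chain.map f ≫ S.m j = S.m i :=
  (S.toBound.naturality f).trans (Category.comp_id _)

lemma InitialSegments.exists_forall_indep (hR : R.IsSimple) {Υ : Cardinal.{v}} [Fact Υ.IsRegular]
    (hΥ : R.HasPresentableBases X Υ) (S : InitialSegments bs) {l : θ.ord.ToType}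
    (hl : Order.IsSuccLimit l) [IsCardinalFiltered (Set.Iio l) Υ] {N' : 𝒦.Model}
    (f : N.obj ⟶ N'.obj) (a : X ⟶ N'.obj) :
    ∃ j < l, ∀ i, j ≤ i → i < l → R.Indep a (S.m l ≫ f) (S.m i ≫ f) := by
  have := S.continuous
  obtain ⟨⟨j, hj⟩, h⟩ := hR.exists_forall_indep_of_isColimit hΥ
    (S.chain.isColimitOfIsWellOrderContinuous l hl) a (S.m l ≫ f)
  refine ⟨j, hj, fun i hji hil => ?_⟩
  have comp_eq : S.chain.map (homOfLE hil.le) ≫ S.m l ≫ f = S.m i ≫ f := by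
    rw [← Category.assoc, S.map_comp_m]
  exact comp_eq ▸ h ⟨i, hil⟩ (homOfLE hji)

end LocalCharacter

lemma exists_isColimit_model {J : Type v} [PartialOrder J] [IsDirectedOrder J] [Nonempty J]
    (F : J ⥤ 𝒦.Obj) (hF : ∀ j, 𝒦.IsModel (F.obj j)) :
    ∃ (U : 𝒦.Model) (ι : F ⟶ (Functor.const J).obj U.obj),
      Nonempty (IsColimit (Cocone.mk U.obj ι)) := by
  have := 𝒦.hasDirectedColimits J
  have := 𝒦.preservesDirectedColimits J
  let G : J ⥤ 𝒦.Model := 𝒦.IsModel.lift F hF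
  exact ⟨colimit G, (𝒦.IsModel.ι.mapCocone (colimit.cocone G)).ι,
    ⟨isColimitOfPreserves 𝒦.IsModel.ι (colimit.isColimit G)⟩⟩

section IndepExt

/-- An extension `m : base ⟶ top` together with a realization `b` in `top` of the Galois type of
`b₀` over `c₀` that is independent from `base` over `c`. These are the stages of the construction
of a long independent isi-sequence, and of the amalgamation along one. -/
structure IndepRel.IndepExt (R : IndepRel 𝒦) {Y Z : 𝒦.Obj} {M : 𝒦.Model} (b₀ : Y ⟶ M.obj)
    (c₀ : Z ⟶ M.obj) where
  base : 𝒦.Model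
  top : 𝒦.Model
  m : base.obj ⟶ top.obj
  b : Y ⟶ top.obj
  c : Z ⟶ base.obj
  indep : R.Indep b m (c ≫ m)
  gtp : GtpEq₂ b (c ≫ m) b₀ c₀

namespace IndepRel.IndepExt

variable {R : IndepRel 𝒦} {Y Z : 𝒦.Obj} {M : 𝒦.Model} {b₀ : Y ⟶ M.obj} {c₀ : Z ⟶ M.obj}

/-- Morphisms of extensions with an independent realization. -/
@[ext]
structure Hom (s t : R.IndepExt b₀ c₀) where
  base : s.base.obj ⟶ t.base.obj
  top : s.top.obj ⟶ t.top.obj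
  m_comp_top : s.m ≫ top = base ≫ t.m
  b_comp_top : s.b ≫ top = t.b
  c_comp_base : s.c ≫ base = t.c

instance : Category (R.IndepExt b₀ c₀) where
  Hom := Hom
  id s := ⟨𝟙 _, 𝟙 _, by simp, by simp, by simp⟩
  comp f g := ⟨f.base ≫ g.base, f.top ≫ g.top, by
    rw [reassoc_of% f.m_comp_top, g.m_comp_top, Category.assoc], by
    rw [reassoc_of% f.b_comp_top, g.b_comp_top], by rw [reassoc_of% f.c_comp_base, g.c_comp_base]⟩
  id_comp f := Hom.ext (Category.id_comp _) (Category.id_comp _)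
  comp_id f := Hom.ext (Category.comp_id _) (Category.comp_id _)
  assoc f g h := Hom.ext (Category.assoc _ _ _) (Category.assoc _ _ _)

/-- The functor sending an extension to its domain. -/
def baseFunctor : R.IndepExt b₀ c₀ ⥤ 𝒦.Obj where
  obj s := s.base.obj
  map f := f.base

/-- The functor sending an extension to its codomain. -/
def topFunctor : R.IndepExt b₀ c₀ ⥤ 𝒦.Obj where
  obj s := s.top.obj
  map f := f.top

/-- The extensions as a natural transformation. -/
def mTrans : (baseFunctor : R.IndepExt b₀ c₀ ⥤ 𝒦.Obj) ⟶ topFunctor where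
  app s := s.m
  naturality _ _ f := f.m_comp_top.symm

/-- The realizations as a natural transformation. -/
def bTrans : (Functor.const _).obj Y ⟶ (topFunctor : R.IndepExt b₀ c₀ ⥤ 𝒦.Obj) where
  app s := s.b
  naturality _ _ f := (Category.id_comp _).trans f.b_comp_top.symm

/-- The parameters `c` as a natural transformation. -/
def cTrans : (Functor.const _).obj Z ⟶ (baseFunctor : R.IndepExt b₀ c₀ ⥤ 𝒦.Obj) where
  app s := s.c
  naturality _ _ f := (Category.id_comp _).trans f.c_comp_base.symm

lemma nonempty_of_isSimple (hR : R.IsSimple) : Nonempty (R.IndepExt b₀ c₀) := by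
  obtain ⟨N, f, b, h, e⟩ := hR.exists_indep_gtpEq₂ b₀ (𝟙 M.obj) c₀
  rw [Category.id_comp] at h
  exact ⟨⟨M, N, f, b, c₀, h, e⟩⟩

lemma exists_hom_top_eq_base (hAP : 𝒦.AmalgamationProperty) (hR : R.IsSimple)
    (s : R.IndepExt b₀ c₀) :
    ∃ (t : R.IndepExt b₀ c₀) (f : s ⟶ t) (e : s.top.obj ⟶ t.base.obj), s.m ≫ e = f.base := by
  obtain ⟨N, f, b', ⟨U, p, q, hb, hm⟩, h⟩ :=
    hR.exists_indep_of_base_le s.indep s.c rfl (𝟙 s.top.obj)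
  have hc : (s.c ≫ s.m) ≫ f ≫ q = s.c ≫ s.m ≫ p := by
    rw [hm, Category.assoc, Category.assoc]
  refine ⟨⟨s.top, U, f ≫ q, s.b ≫ p, s.c ≫ s.m, ?_, ?_⟩, ⟨s.m, p, ?_, rfl, rfl⟩, 𝟙 _,
    Category.comp_id _⟩
  · rw [← hR.indep_comp_iff q, Category.id_comp, ← hb, Category.assoc] at h
    exact h
  · rw [hc, ← Category.assoc]
    exact (GtpEq₂.of_hom _ _ p).symm.trans hAP s.gtp
  · exact hm.trans (Category.assoc _ _ _)

section Colimits

variable {J : Type v} [SmallCategory J] {F : J ⥤ R.IndepExt b₀ c₀} {B T : 𝒦.Model}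

/-- The legs of a cocone over the domains of a diagram of extensions. -/
def baseLeg (β : F ⋙ baseFunctor ⟶ (Functor.const J).obj B.obj) (j : J) :
    (F.obj j).base.obj ⟶ B.obj :=
  β.app j

/-- The legs of a cocone over the codomains of a diagram of extensions. -/
def topLeg (τ : F ⋙ topFunctor ⟶ (Functor.const J).obj T.obj) (j : J) :
    (F.obj j).top.obj ⟶ T.obj :=
  τ.app j

variable {β : F ⋙ baseFunctor ⟶ (Functor.const J).obj B.obj}
  {τ : F ⋙ topFunctor ⟶ (Functor.const J).obj T.obj}

lemma map_base_comp_baseLeg {i j : J} (f : i ⟶ j) :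
    (F.map f).base ≫ baseLeg β j = baseLeg β i :=
  (β.naturality f).trans (Category.comp_id _)

lemma b_comp_topLeg [IsPreconnected J] (i j : J) :
    (F.obj i).b ≫ topLeg τ i = (F.obj j).b ≫ topLeg τ j :=
  nat_trans_from_is_connected (Functor.whiskerLeft F bTrans ≫ τ) i j

lemma c_comp_baseLeg [IsPreconnected J] (i j : J) :
    (F.obj i).c ≫ baseLeg β i = (F.obj j).c ≫ baseLeg β j :=
  nat_trans_from_is_connected (Functor.whiskerLeft F cTrans ≫ β) i j

/-- The arrow from the colimit of the domains to the colimit of the codomains. -/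
def colimitM (hβ : IsColimit (Cocone.mk B.obj β))
    (τ : F ⋙ topFunctor ⟶ (Functor.const J).obj T.obj) : B.obj ⟶ T.obj :=
  hβ.desc ⟨T.obj, Functor.whiskerLeft F mTrans ≫ τ⟩

lemma baseLeg_comp_colimitM (hβ : IsColimit (Cocone.mk B.obj β)) (j : J) :
    baseLeg β j ≫ colimitM hβ τ = (F.obj j).m ≫ topLeg τ j :=
  hβ.fac _ j

lemma gtpEq₂_colimitM (hAP : 𝒦.AmalgamationProperty) (hβ : IsColimit (Cocone.mk B.obj β)) (j : J) :
    GtpEq₂ ((F.obj j).b ≫ topLeg τ j) (((F.obj j).c ≫ baseLeg β j) ≫ colimitM hβ τ) b₀ c₀ := by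
  rw [Category.assoc, baseLeg_comp_colimitM, ← Category.assoc]
  exact (GtpEq₂.of_hom _ _ _).symm.trans hAP (F.obj j).gtp

end Colimits

section DirectedColimits

variable {J : Type v} [PartialOrder J] [IsDirectedOrder J] [Nonempty J]
  {F : J ⥤ R.IndepExt b₀ c₀} {B T : 𝒦.Model}
  {β : F ⋙ baseFunctor ⟶ (Functor.const J).obj B.obj}
  {τ : F ⋙ topFunctor ⟶ (Functor.const J).obj T.obj}

lemma indep_colimitM (hR : R.IsSimple) (hβ : IsColimit (Cocone.mk B.obj β)) (j : J) :
    R.Indep ((F.obj j).b ≫ topLeg τ j) (colimitM hβ τ)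
      (((F.obj j).c ≫ baseLeg β j) ≫ colimitM hβ τ) := by
  have := IsFiltered.isConnected J
  refine hR.union J (F ⋙ baseFunctor) _ hβ (colimitM hβ τ) _ _ fun i => ?_
  have indep_i := (hR.indep_comp_iff (topLeg τ i)).2 (F.obj i).indep
  rwa [Category.assoc, ← baseLeg_comp_colimitM hβ, ← Category.assoc, b_comp_topLeg i j,
    c_comp_baseLeg i j] at indep_i

/-- The colimit of a directed system of extensions, from colimits of the domains and of the
codomains. -/
noncomputable def colimitCocone (hAP : 𝒦.AmalgamationProperty) (hR : R.IsSimple)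
    (hβ : IsColimit (Cocone.mk B.obj β)) (τ : F ⋙ topFunctor ⟶ (Functor.const J).obj T.obj) :
    Cocone F where
  pt :=
    { base := B
      top := T
      m := colimitM hβ τ
      b := (F.obj (Classical.arbitrary J)).b ≫ topLeg τ _
      c := (F.obj (Classical.arbitrary J)).c ≫ baseLeg β _
      indep := indep_colimitM hR hβ _
      gtp := gtpEq₂_colimitM hAP hβ _ }
  ι :=
    { app j :=
        have := IsFiltered.isConnected J
        ⟨baseLeg β j, topLeg τ j, (baseLeg_comp_colimitM hβ j).symm, b_comp_topLeg _ _,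
          c_comp_baseLeg _ _⟩
      naturality _ _ f := Hom.ext (β.naturality f) (τ.naturality f) }

/-- The arrow out of the vertex of `colimitCocone` with given components. -/
def colimitDesc (hAP : 𝒦.AmalgamationProperty) (hR : R.IsSimple)
    (hβ : IsColimit (Cocone.mk B.obj β)) {t : R.IndepExt b₀ c₀} (u : ∀ j, F.obj j ⟶ t)
    {f : B.obj ⟶ t.base.obj} {g : T.obj ⟶ t.top.obj}
    (hf : ∀ j, baseLeg β j ≫ f = (u j).base) (hg : ∀ j, topLeg τ j ≫ g = (u j).top) :
    (colimitCocone hAP hR hβ τ).pt ⟶ t where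
  base := f
  top := g
  m_comp_top := hβ.hom_ext fun j => by
    change baseLeg β j ≫ colimitM hβ τ ≫ g = baseLeg β j ≫ f ≫ t.m
    rw [reassoc_of% baseLeg_comp_colimitM hβ j, hg, (u j).m_comp_top, reassoc_of% hf j]
  b_comp_top := by
    simp only [colimitCocone, Category.assoc, hg, (u _).b_comp_top]
  c_comp_base := by
    simp only [colimitCocone, Category.assoc, hf, (u _).c_comp_base]

/-- The universal property of `colimitCocone`. -/
noncomputable def isColimitColimitCocone (hAP : 𝒦.AmalgamationProperty) (hR : R.IsSimple)
    (hβ : IsColimit (Cocone.mk B.obj β)) (hτ : IsColimit (Cocone.mk T.obj τ)) :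
    IsColimit (colimitCocone hAP hR hβ τ) where
  desc u := colimitDesc hAP hR hβ u.ι.app (hβ.fac (baseFunctor.mapCocone u))
    (hτ.fac (topFunctor.mapCocone u))
  fac _ j := Hom.ext (hβ.fac _ j) (hτ.fac _ j)
  uniq _ _ hf := Hom.ext
    (hβ.uniq (baseFunctor.mapCocone _) _ fun j => congrArg Hom.base (hf j))
    (hτ.uniq (topFunctor.mapCocone _) _ fun j => congrArg Hom.top (hf j))

lemma hasColimitsOfShape (hAP : 𝒦.AmalgamationProperty) (hR : R.IsSimple) :
    HasColimitsOfShape J (R.IndepExt b₀ c₀) where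
  has_colimit F := by
    obtain ⟨B, β, ⟨hβ⟩⟩ := exists_isColimit_model (F ⋙ baseFunctor) fun j => (F.obj j).base.property
    obtain ⟨T, τ, ⟨hτ⟩⟩ := exists_isColimit_model (F ⋙ topFunctor) fun j => (F.obj j).top.property
    exact ⟨⟨⟨_, isColimitColimitCocone hAP hR hβ hτ⟩⟩⟩

lemma preservesColimitsOfShape_baseFunctor (hAP : 𝒦.AmalgamationProperty) (hR : R.IsSimple) :
    PreservesColimitsOfShape J (baseFunctor : R.IndepExt b₀ c₀ ⥤ 𝒦.Obj) where
  preservesColimit {F} := by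
    obtain ⟨B, β, ⟨hβ⟩⟩ := exists_isColimit_model (F ⋙ baseFunctor) fun j => (F.obj j).base.property
    obtain ⟨T, τ, ⟨hτ⟩⟩ := exists_isColimit_model (F ⋙ topFunctor) fun j => (F.obj j).top.property
    exact preservesColimit_of_preserves_colimit_cocone (isColimitColimitCocone hAP hR hβ hτ) hβ

end DirectedColimits

end IndepRel.IndepExt

end IndepExt

section IndepSequences

variable {R : IndepRel 𝒦} {Y Z : 𝒦.Obj} {M : 𝒦.Model} {b : Y ⟶ M.obj} {c : Z ⟶ M.obj}

namespace IndepRel.IndepExt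

lemma gtpEq₂_of_hom {s t : R.IndepExt b c} (f : s ⟶ t) :
    GtpEq₂ s.b s.m t.b (f.base ≫ t.m) := by
  rw [← f.b_comp_top, ← f.m_comp_top]
  exact GtpEq₂.of_hom _ _ _

lemma exists_isWellOrderContinuous_top_factors (hAP : 𝒦.AmalgamationProperty) (hR : R.IsSimple)
    (b : Y ⟶ M.obj) (c : Z ⟶ M.obj) (K : Type v) [LinearOrder K] [SuccOrder K] [NoMaxOrder K]
    [Nonempty K] [WellFoundedLT K] :
    ∃ F : K ⥤ R.IndepExt b c, (F ⋙ baseFunctor).IsWellOrderContinuous ∧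
      ∀ k, ∃ e : (F.obj k).top.obj ⟶ (F.obj (Order.succ k)).base.obj,
        (F.obj k).m ≫ e = (F.map (homOfLE (Order.le_succ k))).base := by
  let := WellFoundedLT.toOrderBot K
  have := nonempty_of_isSimple (b₀ := b) (c₀ := c) hR
  have : HasIterationOfShape K (R.IndepExt b c) :=
    hasIterationOfShape_of_hasColimitsOfShape fun J _ _ => hasColimitsOfShape hAP hR
  let W : MorphismProperty (R.IndepExt b c) :=
    fun s t f => ∃ e : s.top.obj ⟶ t.base.obj, s.m ≫ e = f.base
  obtain ⟨F, hF, hs⟩ := exists_isWellOrderContinuous_forall_map_succ (K := K) W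
    (exists_hom_top_eq_base hAP hR)
  exact ⟨F, isWellOrderContinuous_comp F _ fun J _ _ =>
    preservesColimitsOfShape_baseFunctor hAP hR, hs⟩

end IndepRel.IndepExt

open IndepRel.IndepExt in
lemma IndepRel.IsSimple.exists_indep_isi (hAP : 𝒦.AmalgamationProperty) (hR : R.IsSimple)
    (b : Y ⟶ M.obj) (c : Z ⟶ M.obj) {θ : Cardinal.{v}} (hθ : θ.IsRegular) :
    ∃ (N : 𝒦.Model) (c' : Z ⟶ N.obj) (bs : θ.ord.ToType → (Y ⟶ N.obj)) (S : InitialSegments bs),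
      S.IsIsi ∧ S.Embeds c' ∧ (∀ i, GtpEq₂ (bs i) c' b c) ∧ ∀ i, R.Indep (bs i) (S.m i) c' := by
  have := Cardinal.noMaxOrder hθ.aleph0_le
  have : Nonempty θ.ord.ToType := by
    rw [← Cardinal.mk_ne_zero_iff, Cardinal.mk_ord_toType]
    exact hθ.pos.ne'
  let := WellFoundedLT.toOrderBot θ.ord.ToType
  have := IsFiltered.isConnected θ.ord.ToType
  obtain ⟨F, hF, hs⟩ := exists_isWellOrderContinuous_top_factors hAP hR b c θ.ord.ToType
  choose e he using hs
  obtain ⟨N, ι, -⟩ := exists_isColimit_model (F ⋙ baseFunctor) fun k => (F.obj k).base.property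
  let t k : (F.obj k).top.obj ⟶ N.obj := e k ≫ baseLeg ι (Order.succ k)
  have m_comp_t k : (F.obj k).m ≫ t k = baseLeg ι k := by
    rw [reassoc_of% he k, map_base_comp_baseLeg]
  let bs k : Y ⟶ N.obj := (F.obj k).b ≫ t k
  let S : InitialSegments bs :=
    { chain := F ⋙ baseFunctor
      isModel := fun k => (F.obj k).base.property
      continuous := hF
      toBound := ι
      factors := fun k => ⟨(F.obj k).b ≫ e k, Category.assoc _ _ _⟩ }
  have gtp_leg k : GtpEq₂ (bs k) (baseLeg ι k) (F.obj k).b (F.obj k).m := by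
    rw [← m_comp_t]
    exact (GtpEq₂.of_hom _ _ (t k)).symm
  have c_comp_leg k : (F.obj k).c ≫ baseLeg ι k = (F.obj ⊥).c ≫ baseLeg ι ⊥ :=
    c_comp_baseLeg k ⊥
  refine ⟨N, (F.obj ⊥).c ≫ baseLeg ι ⊥, bs, S, fun i j hij => ?_,
    ⟨⊥, isBot_bot, (F.obj ⊥).c, rfl⟩, fun k => ?_, fun k => ?_⟩
  · have gtp_map := (gtp_leg j).symm.precomp (F.map (homOfLE hij)).base
    rw [map_base_comp_baseLeg] at gtp_map
    exact (gtp_leg i).trans hAP ((gtpEq₂_of_hom _).trans hAP gtp_map)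
  · rw [← c_comp_leg k]
    exact ((gtp_leg k).precomp (F.obj k).c).trans hAP (F.obj k).gtp
  · have indep_t := (hR.indep_comp_iff (t k)).2 (F.obj k).indep
    rwa [Category.assoc, m_comp_t, c_comp_leg] at indep_t

end IndepSequences

section Amalgamation

variable {R : IndepRel 𝒦} {X Y Z W : 𝒦.Obj} {L B M N P : 𝒦.Model}

lemma GtpEq₂.of_span (hAP : 𝒦.AmalgamationProperty) (n : B.obj ⟶ N.obj) (m : B.obj ⟶ P.obj)
    (c : Z ⟶ B.obj) : GtpEq₂ n (c ≫ n) m (c ≫ m) := by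
  obtain ⟨U, p, q, e⟩ := hAP B N P n m
  exact ⟨U, p, q, e, by rw [Category.assoc, e, Category.assoc]⟩

-- 3-amalgamation with the model `N` as third object, next to the two realizations.
lemma IndepRel.IndepExt.exists_amalgam (hAP : 𝒦.AmalgamationProperty) (hR : R.IsSimple)
    {a₁ : X ⟶ M.obj} {b₁ : Y ⟶ M.obj} {m₁ : L.obj ⟶ M.obj} (h₁ : R.Indep a₁ b₁ m₁)
    (s : R.IndepExt a₁ m₁) (n : s.base.obj ⟶ N.obj) {d : Y ⟶ N.obj} (hd : R.Indep d n (s.c ≫ n))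
    (e : GtpEq₂ b₁ m₁ d (s.c ≫ n)) :
    ∃ (P : 𝒦.Model) (f : N.obj ⟶ P.obj) (g : s.top.obj ⟶ P.obj), n ≫ f = s.m ≫ g ∧
      R.Indep (s.b ≫ g) f (s.c ≫ n ≫ f) ∧ GtpEq₃ a₁ b₁ m₁ (s.b ≫ g) (d ≫ f) (s.c ≫ n ≫ f) := by
  obtain ⟨P, f₁, f, g, ha, hb, hn, hm, -, hind⟩ := hR.threeAmalgamation a₁ s.b b₁ d n s.m m₁
    (s.c ≫ n) (s.c ≫ s.m) h₁ hd (hR.indep_symm s.indep) s.gtp.symm e (GtpEq₂.of_span hAP n s.m s.c)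
  rw [Category.assoc] at hm
  refine ⟨P, f, g, hn, ?_, ?_⟩
  · rwa [← ha, ← hm]
  · rw [← ha, ← hb, ← hm]
    exact GtpEq₃.of_hom a₁ b₁ m₁ f₁

/-- A stage of the amalgamation of `gtp(a₁, m₁)` with `N`: an extension with an independent
realization of `gtp(a₁, m₁)` whose domain is embedded in `N`. -/
abbrev IndepRel.Stage (R : IndepRel 𝒦) (a₁ : X ⟶ M.obj) (m₁ : Z ⟶ M.obj) (N : 𝒦.Model) :=
  CostructuredArrow (IndepExt.baseFunctor : R.IndepExt a₁ m₁ ⥤ 𝒦.Obj) N.obj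

namespace IndepRel.Stage

open IndepExt

variable {a₁ : X ⟶ M.obj} {b₁ : Y ⟶ M.obj} {m₁ : Z ⟶ M.obj}

/-- The arrow into `N` of a stage. -/
def toN (s : R.Stage a₁ m₁ N) : s.left.base.obj ⟶ N.obj := s.hom

lemma base_comp_toN {s t : R.Stage a₁ m₁ N} (f : s ⟶ t) :
    f.left.base ≫ t.toN = s.toN :=
  CostructuredArrow.w f

lemma c_comp_toN {s t : R.Stage a₁ m₁ N} (f : s ⟶ t) :
    t.left.c ≫ t.toN = s.left.c ≫ s.toN := by
  rw [← f.left.c_comp_base, Category.assoc, base_comp_toN]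

/-- The stages at which `gtp(a₁, b₁, m₁)` is realized, with `d` in the role of `b₁`. -/
def Realizes (b₁ : Y ⟶ M.obj) (d : Y ⟶ N.obj) : ObjectProperty (R.Stage a₁ m₁ N) :=
  fun s => ∃ g : Y ⟶ s.left.base.obj, g ≫ s.toN = d ∧
    GtpEq₃ a₁ b₁ m₁ s.left.b (g ≫ s.left.m) (s.left.c ≫ s.left.m)

lemma Realizes.of_hom (hAP : 𝒦.AmalgamationProperty) {d : Y ⟶ N.obj} {s t : R.Stage a₁ m₁ N}
    (f : s ⟶ t) (h : Realizes b₁ d s) : Realizes b₁ d t := by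
  obtain ⟨g, hg, e⟩ := h
  refine ⟨g ≫ f.left.base, by rw [Category.assoc, base_comp_toN, hg], ?_⟩
  have gtp_top := e.trans hAP (GtpEq₃.of_hom _ _ _ f.left.top)
  rwa [Category.assoc, Category.assoc, f.left.m_comp_top, ← Category.assoc, ← Category.assoc,
    f.left.b_comp_top, f.left.c_comp_base] at gtp_top

lemma exists_hom_realizes (hAP : 𝒦.AmalgamationProperty) (hR : R.IsSimple)
    {m₁ : L.obj ⟶ M.obj} (h₁ : R.Indep a₁ b₁ m₁) (s : R.Stage a₁ m₁ N)
    (p : s.left.base.obj ⟶ B.obj) (q : B.obj ⟶ N.obj) (hpq : p ≫ q = s.toN) (g : Y ⟶ B.obj)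
    (hg : R.Indep (g ≫ q) s.toN (s.left.c ≫ s.toN))
    (e : GtpEq₂ b₁ m₁ (g ≫ q) (s.left.c ≫ s.toN)) :
    ∃ t : R.Stage a₁ m₁ N, Nonempty (s ⟶ t) ∧ Realizes b₁ (g ≫ q) t ∧
      costructuredArrowFactors _ q t := by
  obtain ⟨P, f, f', hf, hind, hgtp⟩ := s.left.exists_amalgam hAP hR h₁ s.toN hg e
  rw [← hpq] at hf hind hgtp
  let t : R.IndepExt a₁ m₁ :=
    { base := B
      top := P
      m := q ≫ f
      b := s.left.b ≫ f'
      c := s.left.c ≫ p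
      indep := by simpa only [Category.assoc] using hR.indep_precomp_right hind q
      gtp := by simpa only [Category.assoc] using hgtp.gtpEq₂.symm }
  let toT : s.left ⟶ t := ⟨p, f', by simpa only [Category.assoc] using hf.symm, rfl, rfl⟩
  have hgtp' : GtpEq₃ a₁ b₁ m₁ (s.left.b ≫ f') (g ≫ q ≫ f) ((s.left.c ≫ p) ≫ q ≫ f) := by
    simpa only [Category.assoc] using hgtp
  exact ⟨.mk (Y := t) q, ⟨CostructuredArrow.homMk toT hpq⟩, ⟨g, rfl, hgtp'⟩, 𝟙 _,
    Category.id_comp _⟩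

lemma exists_consistent (hAP : 𝒦.AmalgamationProperty) (s : R.Stage a₁ m₁ N) {I : Type v}
    {bs : I → (Y ⟶ N.obj)} (h : ∀ i, Realizes b₁ (bs i) s) :
    Consistent a₁ b₁ m₁ bs (s.left.c ≫ s.toN) := by
  obtain ⟨U, f, g, hfg⟩ := hAP s.left.base N s.left.top s.toN s.left.m
  refine ⟨U, f, s.left.b ≫ g, fun i => ?_⟩
  obtain ⟨t, ht, e⟩ := h i
  rw [← ht, Category.assoc, Category.assoc, hfg]
  simpa only [Category.assoc] using e.trans hAP (GtpEq₃.of_hom _ _ _ g)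

end IndepRel.Stage

end Amalgamation

namespace InitialSegments

variable {θ : Cardinal.{v}} {X Y Z : 𝒦.Obj} {M N : 𝒦.Model} {bs : θ.ord.ToType → (Y ⟶ N.obj)}
  {S : InitialSegments bs}

lemma exists_comp_m_eq (S : InitialSegments bs) {i j : θ.ord.ToType} (h : Order.succ i ≤ j) :
    ∃ g : Y ⟶ S.chain.obj j, g ≫ S.m j = bs i := by
  obtain ⟨g, hg⟩ := S.factors i
  exact ⟨g ≫ S.chain.map (homOfLE h), by rw [Category.assoc, map_comp_m]; exact hg⟩

lemma Embeds.exists_comp_m_eq {c : Z ⟶ N.obj} (h : S.Embeds c) (j : θ.ord.ToType) :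
    ∃ g : Z ⟶ S.chain.obj j, g ≫ S.m j = c := by
  obtain ⟨i, hi, g, hg⟩ := h
  exact ⟨g ≫ S.chain.map (homOfLE (hi j)), by rw [Category.assoc, map_comp_m, hg]⟩

section Amalgamation

open IndepRel.Stage

variable {R : IndepRel 𝒦} {j : θ.ord.ToType} {T : Set θ.ord.ToType}
  {a₁ : X ⟶ M.obj} {b₁ : Y ⟶ M.obj} {m₁ : S.chain.obj j ⟶ M.obj}

/-- The stages over the `j`-th model of a chain that decide every `k ∈ T`: they realize
`gtp(a₁, b₁, m₁)` at `bs k`, or are still contained in the `k`-th model. -/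
def IsPartialAmalgam (b₁ : Y ⟶ M.obj) (T : Set θ.ord.ToType) :
    ObjectProperty (R.Stage a₁ m₁ N) :=
  fun s => s.left.c ≫ s.toN = S.m j ∧
    ∀ k ∈ T, (Realizes b₁ (bs k) ⊔ costructuredArrowFactors _ (S.m k)) s

lemma isClosedUnderColimitsOfShape_isPartialAmalgam (hAP : 𝒦.AmalgamationProperty)
    (hR : R.IsSimple) (J : Type v) [PartialOrder J] [IsDirectedOrder J] [Nonempty J] :
    (IsPartialAmalgam b₁ T : ObjectProperty (R.Stage a₁ m₁ N)).IsClosedUnderColimitsOfShape J where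
  colimitsOfShape_le := fun s ⟨p⟩ => by
    have := IndepRel.IndepExt.hasColimitsOfShape (J := J) (b₀ := a₁) (c₀ := m₁) hAP hR
    have := IndepRel.IndepExt.preservesColimitsOfShape_baseFunctor (J := J) (b₀ := a₁) (c₀ := m₁)
      hAP hR
    refine ⟨(c_comp_toN (p.ι.app (Classical.arbitrary J))).trans (p.prop_diag_obj _).1,
      fun k hk => ?_⟩
    have := isClosedUnderColimitsOfShape_costructuredArrowFactors (J := J)
      (G := (IndepRel.IndepExt.baseFunctor : R.IndepExt a₁ m₁ ⥤ 𝒦.Obj)) (S.m k)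
    have closed := isClosedUnderColimitsOfShape_sup_of_forall_hom (J := J)
      (Q := costructuredArrowFactors (IndepRel.IndepExt.baseFunctor : R.IndepExt a₁ m₁ ⥤ _) (S.m k))
      fun f => Realizes.of_hom (b₁ := b₁) (d := bs k) hAP f
    exact ObjectProperty.prop_of_isColimit _ p.isColimit fun i => (p.prop_diag_obj i).2 k hk

lemma exists_isPartialAmalgam (hR : R.IsSimple) (hT : ∀ k ∈ T, j ≤ k) :
    ∃ s, (IsPartialAmalgam b₁ T : ObjectProperty (R.Stage a₁ m₁ N)) s := by
  let s : R.IndepExt a₁ m₁ :=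
    { base := ⟨S.chain.obj j, S.isModel j⟩
      top := M
      m := m₁
      b := a₁
      c := 𝟙 _
      indep := by simpa only [Category.id_comp] using hR.indep_self_right a₁ m₁
      gtp := by simpa only [Category.id_comp, Category.comp_id] using GtpEq₂.of_hom a₁ m₁ (𝟙 _) }
  exact ⟨.mk (Y := s) (S.m j), Category.id_comp _, fun k hk =>
    Or.inr ⟨S.chain.map (homOfLE (hT k hk)), S.map_comp_m _⟩⟩

lemma exists_hom_isPartialAmalgam_realizes (hAP : 𝒦.AmalgamationProperty) (hR : R.IsSimple)
    (h₁ : R.Indep a₁ b₁ m₁) {s : R.Stage a₁ m₁ N} (hs : IsPartialAmalgam b₁ T s)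
    {k : θ.ord.ToType} (hk : k ∈ T) (hlt : ∀ i ∈ T, i < k → Realizes b₁ (bs i) s)
    (hind : R.Indep (bs k) (S.m k) (S.m j)) (e : GtpEq₂ b₁ m₁ (bs k) (S.m j)) :
    ∃ t, IsPartialAmalgam b₁ T t ∧ Nonempty (s ⟶ t) ∧ Realizes b₁ (bs k) t := by
  rcases hs.2 k hk with hrel | hbelow
  · exact ⟨s, hs, ⟨𝟙 s⟩, hrel⟩
  obtain ⟨p, hp⟩ : ∃ p : s.left.base.obj ⟶ S.chain.obj k, p ≫ S.m k = s.toN := hbelow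
  obtain ⟨g, hg⟩ := S.exists_comp_m_eq (le_refl (Order.succ k))
  obtain ⟨t, ⟨f⟩, hrel, q, hq⟩ := s.exists_hom_realizes (L := ⟨_, S.isModel j⟩)
    (B := ⟨_, S.isModel (Order.succ k)⟩) hAP hR h₁
    (p ≫ S.chain.map (homOfLE (Order.le_succ k))) (S.m (Order.succ k))
    (by rw [Category.assoc, map_comp_m, hp]) g
    (by rw [hg, hs.1, ← hp]; exact hR.indep_precomp_right hind p) (by rwa [hg, hs.1])
  rw [hg] at hrel
  refine ⟨t, ⟨(c_comp_toN f).trans hs.1, fun i hi => ?_⟩, ⟨f⟩, hrel⟩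
  rcases lt_trichotomy i k with hik | rfl | hki
  · exact Or.inl ((hlt i hi hik).of_hom hAP f)
  · exact Or.inl hrel
  · refine Or.inr ⟨q ≫ S.chain.map (homOfLE (Order.succ_le_of_lt hki)), ?_⟩
    rw [Category.assoc, map_comp_m, hq]

lemma consistent_of_indep [NoMaxOrder θ.ord.ToType] (hAP : 𝒦.AmalgamationProperty)
    (hR : R.IsSimple) (h₁ : R.Indep a₁ b₁ m₁) (hT : ∀ k ∈ T, j ≤ k)
    (hind : ∀ k ∈ T, R.Indep (bs k) (S.m k) (S.m j))
    (hgtp : ∀ k ∈ T, GtpEq₂ b₁ m₁ (bs k) (S.m j)) :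
    Consistent a₁ b₁ m₁ (fun k : T => bs k) (S.m j) := by
  let P : ObjectProperty (R.Stage a₁ m₁ N) := IsPartialAmalgam b₁ T
  have : Nonempty P.FullSubcategory :=
    (exists_isPartialAmalgam hR hT).elim fun s hs => ⟨⟨s, hs⟩⟩
  have : Nonempty θ.ord.ToType := ⟨j⟩
  let := WellFoundedLT.toOrderBot θ.ord.ToType
  have : HasIterationOfShape θ.ord.ToType P.FullSubcategory :=
    hasIterationOfShape_of_hasColimitsOfShape fun J _ _ => by
      have := IndepRel.IndepExt.hasColimitsOfShape (J := J) (b₀ := a₁) (c₀ := m₁) hAP hR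
      have := IndepRel.IndepExt.preservesColimitsOfShape_baseFunctor (J := J) (b₀ := a₁) (c₀ := m₁)
        hAP hR
      have : P.IsClosedUnderColimitsOfShape J :=
        isClosedUnderColimitsOfShape_isPartialAmalgam hAP hR J
      infer_instance
  obtain ⟨s, hs⟩ := exists_forall_of_forall_exists_hom (D := P.FullSubcategory)
    (fun (k : θ.ord.ToType) s => k ∈ T → Realizes b₁ (bs k) s.obj)
    (fun f h hk => (h hk).of_hom hAP (P.ι.map f)) fun k s hlt => by
      by_cases hk : k ∈ T
      · obtain ⟨t, ht, ⟨f⟩, hrel⟩ := exists_hom_isPartialAmalgam_realizes hAP hR h₁ s.property hk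
          (fun i hi hik => hlt i hik hi) (hind k hk) (hgtp k hk)
        exact ⟨⟨t, ht⟩, ⟨ObjectProperty.homMk f⟩, fun _ => hrel⟩
      · exact ⟨s, ⟨𝟙 s⟩, fun h => (hk h).elim⟩
  rw [← s.property.1]
  exact s.obj.exists_consistent hAP fun k => hs k k.2

end Amalgamation

end InitialSegments

section Dividing

variable {R : IndepRel 𝒦} {θ : Cardinal.{v}} {X Y Z : 𝒦.Obj} {M N : 𝒦.Model}
  {a : X ⟶ M.obj} {b : Y ⟶ M.obj} {c : Z ⟶ M.obj}

namespace InitialSegments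

variable {bs : θ.ord.ToType → (Y ⟶ N.obj)} {S : InitialSegments bs}

lemma IsIsi.indep_of_le (hS : S.IsIsi) (hR : R.IsSimple) {i j l : θ.ord.ToType}
    (h : R.Indep (bs l) (S.m l) (S.m j)) (hji : j ≤ i) (hil : i ≤ l) :
    R.Indep (bs i) (S.m i) (S.m j) := by
  have indep_at := hR.indep_precomp_right h (S.chain.map (homOfLE hil))
  have gtp := (hS i l hil).symm.gtpEq₃ (S.chain.map (homOfLE hji))
  rw [map_comp_m] at indep_at gtp
  exact hR.indep_of_gtpEq₃ indep_at gtp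

-- 3-amalgamation needs a model as base, so `c` is first replaced by `S.m j`.
lemma IsIsi.consistent_Ico [NoMaxOrder θ.ord.ToType] (hS : S.IsIsi)
    (hAP : 𝒦.AmalgamationProperty) (hR : R.IsSimple) (h : R.Indep a b c) {c' : Z ⟶ N.obj}
    (hc : S.Embeds c') (hgtp : ∀ i, GtpEq₂ (bs i) c' b c) {j l : θ.ord.ToType}
    (hind : R.Indep (bs l) (S.m l) (S.m j)) :
    Consistent a b c (fun k : Set.Ico j l => bs k) c' := by
  obtain ⟨g, hg⟩ := S.exists_comp_m_eq (le_refl (Order.succ j))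
  obtain ⟨s, hs⟩ := hc.exists_comp_m_eq j
  obtain ⟨N', f, a', e, ha'⟩ :=
    hR.exists_indep_of_gtpEq₂ hAP h (hgtp j).symm (S.m (Order.succ j))
  have base_mono : R.Indep a' (S.m (Order.succ j) ≫ f) (S.m j ≫ f) :=
    hR.indep_base_mono ha' s (by rw [reassoc_of% hs]) (S.chain.map (homOfLE (Order.le_succ j)))
      (by rw [← Category.assoc, map_comp_m])
  have indep_bs : R.Indep a' (bs j ≫ f) (S.m j ≫ f) := by
    simpa only [reassoc_of% hg] using hR.indep_precomp_right base_mono g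
  have over_segment := consistent_of_indep (T := Set.Ico j l) hAP hR indep_bs
    (fun k hk => hk.1) (fun k hk => hS.indep_of_le hR hind hk.1 hk.2.le)
    fun k hk => (GtpEq₂.of_hom (bs j) (S.m j) f).symm.trans hAP (hS j k hk.1)
  have over_c := over_segment.precomp s
  rw [reassoc_of% hs, hs] at over_c
  exact over_c.of_gtpEq₃ hAP e

lemma indep_of_consistent (hR : R.IsSimple) {Υ : Cardinal.{v}}
    [Fact Υ.IsRegular] (hΥ : R.HasPresentableBases X Υ) (hθ : θ.IsRegular) (hΥθ : Υ < θ)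
    {c' : Z ⟶ N.obj} (hc : S.Embeds c') (hind : ∀ i, R.Indep (bs i) (S.m i) c')
    {I : Set θ.ord.ToType} (hI : Υ ≤ Cardinal.mk I)
    (hcons : Consistent a b c (fun i : I => bs i) c') : R.Indep a b c := by
  obtain ⟨N', f, a', ha'⟩ := hcons
  obtain ⟨l, hl, _, htail⟩ :=
    exists_isSuccLimit_isCardinalFiltered_Iio (exists_le_mk_inter_Iio hθ hΥθ hI)
  obtain ⟨k, hkl, hk⟩ := S.exists_forall_indep hR hΥ hl f a'
  obtain ⟨x, hxI, hkx, hxl⟩ : (I ∩ Set.Ioo k l).Nonempty := by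
    rw [← Set.nonempty_coe_sort, ← Cardinal.mk_ne_zero_iff]
    exact ((Fact.out : Υ.IsRegular).pos.trans_le (htail k hkl)).ne'
  obtain ⟨g, hg⟩ := S.exists_comp_m_eq (hl.succ_lt hxl).le
  obtain ⟨s, hs⟩ := hc.exists_comp_m_eq x
  have a'_indep_bs : R.Indep a' (bs x ≫ f) (S.m x ≫ f) := by
    simpa only [reassoc_of% hg] using hR.indep_precomp_right (hk x hkx.le hxl) g
  have bs_indep_a' : R.Indep (bs x ≫ f) a' (c' ≫ f) :=
    hR.indep_trans ((hR.indep_comp_iff f).2 (hind x)) (hR.indep_symm a'_indep_bs) s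
      (by rw [reassoc_of% hs])
  exact hR.indep_of_gtpEq₃ (hR.indep_symm bs_indep_a') (ha' ⟨x, hxI⟩).symm

end InitialSegments

namespace IndepRel.IsSimple

theorem isiDivides_of_not_indep (hAP : 𝒦.AmalgamationProperty) (hR : R.IsSimple)
    (h : ¬ R.Indep a b c) : IsiDivides a b c := by
  obtain ⟨Υ, hreg, hΥ⟩ := hR.exists_hasPresentableBases X
  refine ⟨Order.succ Υ, Cardinal.isRegular_succ hreg.out.aleph0_le, fun θ hθ hle => ?_⟩
  have hΥθ : Υ < θ := Order.succ_le_iff.1 hle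
  obtain ⟨N, c', bs, S, hS, hc, hgtp, hind⟩ := hR.exists_indep_isi hAP b c hθ
  exact ⟨N, c', bs, S, hS, hc, hgtp, Υ, hreg.out, hΥθ, fun I hI hcons =>
    h (InitialSegments.indep_of_consistent hR hΥ hθ hΥθ hc hind hI hcons)⟩

theorem not_isiDivides_of_indep (hAP : 𝒦.AmalgamationProperty) (hR : R.IsSimple)
    (h : R.Indep a b c) : ¬ IsiDivides a b c := by
  rintro ⟨μ, hμ, hdiv⟩
  obtain ⟨Υ, hreg, hΥ⟩ := hR.exists_hasPresentableBases Y
  let ν := Order.succ (max μ Υ)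
  have hν : Fact ν.IsRegular :=
    ⟨Cardinal.isRegular_succ (hμ.aleph0_le.trans (le_max_left _ _))⟩
  have hθ : (Order.succ ν).IsRegular := Cardinal.isRegular_succ hν.out.aleph0_le
  have hμν : μ ≤ ν := (le_max_left _ _).trans (Order.le_succ _)
  have hΥν : Υ ≤ ν := (le_max_right _ _).trans (Order.le_succ _)
  obtain ⟨N, c', bs, S, hS, hc, hgtp, κ, -, hκ, hno⟩ :=
    hdiv (Order.succ ν) hθ (hμν.trans (Order.le_succ ν))
  have := Cardinal.noMaxOrder hθ.aleph0_le
  have hν_univ : ν ≤ Cardinal.mk (Set.univ : Set (Order.succ ν).ord.ToType) := by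
    rw [Cardinal.mk_univ, Cardinal.mk_toType, Cardinal.card_ord]
    exact Order.le_succ ν
  obtain ⟨l, hl, _, htail⟩ := exists_isSuccLimit_isCardinalFiltered_Iio
    (exists_le_mk_inter_Iio hθ (Order.lt_succ ν) hν_univ)
  have := IsCardinalFiltered.of_le (Set.Iio l) hΥν
  obtain ⟨j, hjl, hj⟩ := S.exists_forall_indep hR hΥ hl (𝟙 N.obj) (bs l)
  have hind : R.Indep (bs l) (S.m l) (S.m j) := by
    simpa only [Category.comp_id] using hj j le_rfl hjl
  have hcard : κ ≤ Cardinal.mk (Set.Ico j l) :=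
    (Order.lt_succ_iff.1 hκ).trans <| (htail j hjl).trans <|
      Cardinal.mk_le_mk_of_subset fun i hi => ⟨hi.2.1.le, hi.2.2⟩
  exact hno _ hcard (hS.consistent_Ico hAP hR h hc hgtp hind)

end IndepRel.IsSimple

end Dividing

end AECat

theorem mainTheorem1 (𝒦 : AECat.{v, u}) (hAP : 𝒦.AmalgamationProperty)
    (R : AECat.IndepRel 𝒦) (hR : R.IsSimple)
    (M : 𝒦.Model) (A B C : Subobject M.obj)
    -- arbitrary representatives of the three subobjects
    {X Y Z : 𝒦.Obj} (a : X ⟶ M.obj) (b : Y ⟶ M.obj) (c : Z ⟶ M.obj)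
    (ha : Subobject.mk a = A) (hb : Subobject.mk b = B) (hc : Subobject.mk c = C) :
    R A B C ↔ ¬ AECat.IsiDivides a b c := by
  subst ha hb hc
  exact ⟨hR.not_isiDivides_of_indep hAP, fun h => by
    by_contra h'
    exact h (hR.isiDivides_of_not_indep hAP h')⟩
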